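/- Let $m$ be a positive integer, $n=2m$, and let $\lambda_1,\lambda_2,\lambda_3\in\mathbb F_{2^m}^{\star}$ be linearly independent over $\mathbb F_2$. Put $t_1=0$ if $(\lambda_1+\lambda_2+\lambda_3)^{-1}=\lambda_1^{-1}+\lambda_2^{-1}+\lambda_3^{-1}$ and $t_1=1$ otherwise; for $1\le j_1<j_2\le 3$ put $t_{j_1+j_2-1}=0$ if $(\lambda_{j_1}+\lambda_{j_2})^{-1}=\lambda_{j_1}^{-1}+\lambda_{j_2}^{-1}$ and $t_{j_1+j_2-1}=1$ otherwise. Let $\mathrm{wt}(t_1,t_2,t_3,t_4)$ be the number of $i$ with $t_i=1$. Assume that $m\ge \mathrm{wt}(t_1,t_2,t_3,t_4)+3$ and that the $\mathbb F_2$-span of $$\{\lambda_1^{-1},\ \lambda_2^{-1},\ \lambda_3^{-1},\ (\lambda_1+\lambda_2)^{-1},\ (\lambda_1+\lambda_3)^{-1},\ (\lambda_2+\lambda_3)^{-1},\ (\lambda_1+\lambda_2+\lambda_3)^{-1}\}$$ has dimension $\mathrm{wt}(t_1,t_2,t_3,t_4)+3$. Let $f:\mathbb F_{2^n}\to\mathbb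 F_2$, $f(x)=\prod_{i=1}^{3}\mathrm{Tr}_1^m(\lambda_i x^{2^m+1})$, where $\mathrm{Tr}_1^k$ is the trace from $\mathbb F_{2^k}$ to $\mathbb F_2$, and let $$\mathcal C_f^{\star}=\{(\alpha f(x)-\mathrm{Tr}_1^n(\beta x))_{x\in\mathbb F_{2^n}^{\star}} : \alpha\in\mathbb F_2,\ \beta\in\mathbb F_{2^n}\}.$$ Then $\mathcal C_f^{\star}$ is a binary linear code that is self-orthogonal ($\mathbf a\cdot\mathbf b=0$ for all codewords $\mathbf a,\mathbf b$), doubly-even (all Hamming weights are divisible by $4$) and minimal (if the support of a nonzero codeword $\mathbf a$ contains the support of a codeword $\mathbf b$, then $\mathbf b\in\{0,\mathbf a\}$), and it violates the Ashikhmin–Barg condition $\frac12<\frac{w_{\min}}{w_{\max}}$, where $w_{\min}$ and $w_{\max}$ are the least and greatest Hamming weights of its nonzero codewords. -/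

import Mathlib

section LinearCodes

variable {R ι : Type*} [Field R] [DecidableEq R] [Fintype ι]

/-- The Euclidean dual of a linear code `C ⊆ R^ι`. -/
def dualCode (C : Submodule R (ι → R)) : Submodule R (ι → R) where
  carrier := {b | ∀ c ∈ C, b ⬝ᵥ c = 0}
  add_mem' := by
    intro a b ha hb c hc
    rw [add_dotProduct, ha c hc, hb c hc, add_zero]
  zero_mem' := by
    intro c _
    exact zero_dotProduct c
  smul_mem' := by
    intro r a ha c hc
    rw [smul_dotProduct, ha c hc, smul_zero]

/-- A linear code is self-orthogonal if it is contained in its dual. -/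
def IsSelfOrthogonal (C : Submodule R (ι → R)) : Prop := C ≤ dualCode C

/-- Every codeword has Hamming weight divisible by four. -/
def IsDoublyEven (C : Submodule R (ι → R)) : Prop := ∀ c ∈ C, 4 ∣ hammingNorm c

/-- The codeword `a` covers the codeword `b`. -/
def Covers (a b : ι → R) : Prop := Function.support b ⊆ Function.support a

/-- A nonzero codeword of `C` is minimal if the only codewords that it covers are its
scalar multiples. -/
def IsMinimalCodeword (C : Submodule R (ι → R)) (a : ι → R) : Prop :=
  a ∈ C ∧ a ≠ 0 ∧ ∀ b ∈ C, Covers a b → ∃ r : R, b = r • a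

/-- A linear code is minimal if all its nonzero codewords are minimal. -/
def IsMinimalCode (C : Submodule R (ι → R)) : Prop :=
  ∀ a ∈ C, a ≠ 0 → IsMinimalCodeword C a

/-- The set of Hamming weights of the nonzero codewords of `C`. -/
def nonzeroWeights (C : Submodule R (ι → R)) : Set ℕ :=
  {w | ∃ c ∈ C, c ≠ 0 ∧ hammingNorm c = w}

/-- `C` has a least and a greatest nonzero weight `wmin`, `wmax`, and the Ashikhmin–Barg
condition `(q - 1) / q < wmin / wmax` fails, where `q` is the size of the alphabet. -/
def ViolatesAshikhminBarg (C : Submodule R (ι → R)) : Prop :=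
  ∃ wmin wmax : ℕ, IsLeast (nonzeroWeights C) wmin ∧ IsGreatest (nonzeroWeights C) wmax ∧
    ¬ (((Nat.card R : ℚ) - 1) / (Nat.card R : ℚ) < (wmin : ℚ) / (wmax : ℚ))

end LinearCodes

section Construction

variable (K : Type*) [Field K] [Algebra (ZMod 2) K]

/-- The subfield `{y | y ^ (2 ^ m) = y}` of a field of characteristic two. It is the field with
`2 ^ m` elements if `K` has `2 ^ (2 * m)` elements. -/
def subfieldTwoPow (m : ℕ) : IntermediateField (ZMod 2) K where
  carrier := {y | y ^ (2 ^ m) = y}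
  mul_mem' := by
    intro a b ha hb
    change (a * b) ^ (2 ^ m) = a * b
    rw [mul_pow, Set.mem_ofPred_eq.mp ha, Set.mem_ofPred_eq.mp hb]
  add_mem' := by
    intro a b ha hb
    have : CharP K 2 := charP_of_injective_algebraMap (algebraMap (ZMod 2) K).injective 2
    change (a + b) ^ (2 ^ m) = a + b
    rw [add_pow_char_pow, Set.mem_ofPred_eq.mp ha, Set.mem_ofPred_eq.mp hb]
  algebraMap_mem' := by
    intro r
    change (algebraMap (ZMod 2) K r) ^ (2 ^ m) = algebraMap (ZMod 2) K r
    rw [← map_pow, ZMod.pow_card_pow]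
  inv_mem' := by
    intro a ha
    change (a⁻¹) ^ (2 ^ m) = a⁻¹
    rw [inv_pow, Set.mem_ofPred_eq.mp ha]

variable {K}

/-- `x ^ (2 ^ m + 1)`, as an element of the subfield with `2 ^ m` elements. -/
def powToSubfield [Fintype K] {m : ℕ} (hK : Fintype.card K = 2 ^ (2 * m)) (x : K) :
    subfieldTwoPow K m :=
  ⟨x ^ (2 ^ m + 1), by
    change (x ^ (2 ^ m + 1)) ^ (2 ^ m) = x ^ (2 ^ m + 1)
    have h : x ^ (2 ^ (2 * m)) = x := hK ▸ FiniteField.pow_card x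
    rw [← pow_mul, add_mul, one_mul, ← pow_add, ← two_mul, pow_add, h, pow_succ, mul_comm]⟩

/-- The Boolean function `x ↦ Tr_1^m (l * x ^ (2 ^ m + 1))`. -/
noncomputable def traceNormFun [Fintype K] {m : ℕ} (hK : Fintype.card K = 2 ^ (2 * m))
    (l : subfieldTwoPow K m) (x : K) : ZMod 2 :=
  Algebra.trace (ZMod 2) (subfieldTwoPow K m) (l * powToSubfield hK x)

/-- The product of the three Boolean functions attached to `l 0`, `l 1`, `l 2`. -/
noncomputable def cubicFun [Fintype K] {m : ℕ} (hK : Fintype.card K = 2 ^ (2 * m))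
    (l : Fin 3 → subfieldTwoPow K m) (x : K) : ZMod 2 :=
  traceNormFun hK (l 0) x * traceNormFun hK (l 1) x * traceNormFun hK (l 2) x

/-- The binary linear code `{(α f(x) - Tr_1^n (β x))_{x ≠ 0} | α ∈ 𝔽₂, β ∈ K}`. -/
noncomputable def codeStar (f : K → ZMod 2) :
    Submodule (ZMod 2) ({x : K // x ≠ 0} → ZMod 2) where
  carrier := {c | ∃ (α : ZMod 2) (β : K),
    c = fun x => α * f x.1 - Algebra.trace (ZMod 2) K (β * x.1)}
  add_mem' := by
    rintro _ _ ⟨α, β, rfl⟩ ⟨α', β', rfl⟩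
    refine ⟨α + α', β + β', ?_⟩
    funext x
    simp only [Pi.add_apply, add_mul, map_add]
    ring
  zero_mem' := by
    refine ⟨0, 0, ?_⟩
    funext x
    simp
  smul_mem' := by
    rintro r _ ⟨α, β, rfl⟩
    refine ⟨r * α, r • β, ?_⟩
    funext x
    simp only [Pi.smul_apply, smul_eq_mul, Algebra.smul_mul_assoc, map_smul]
    ring

open scoped Classical in
/-- The vector `(t₁, t₂, t₃, t₄)` recording which of the four relations
`(l₁ + l₂ + l₃)⁻¹ = l₁⁻¹ + l₂⁻¹ + l₃⁻¹`, `(lᵢ + lⱼ)⁻¹ = lᵢ⁻¹ + lⱼ⁻¹` fail. -/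
noncomputable def relationVec {F : Type*} [Field F] (l : Fin 3 → F) : Fin 4 → ZMod 2 :=
  ![if (l 0 + l 1 + l 2)⁻¹ = (l 0)⁻¹ + (l 1)⁻¹ + (l 2)⁻¹ then 0 else 1,
    if (l 0 + l 1)⁻¹ = (l 0)⁻¹ + (l 1)⁻¹ then 0 else 1,
    if (l 0 + l 2)⁻¹ = (l 0)⁻¹ + (l 2)⁻¹ then 0 else 1,
    if (l 1 + l 2)⁻¹ = (l 1)⁻¹ + (l 2)⁻¹ then 0 else 1]

/-- The inverses of the seven nonzero `𝔽₂`-combinations of `l 0`, `l 1`, `l 2`. -/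
def inverseSet {F : Type*} [Field F] (l : Fin 3 → F) : Set F :=
  {(l 0)⁻¹, (l 1)⁻¹, (l 2)⁻¹, (l 0 + l 2)⁻¹, (l 0 + l 1)⁻¹, (l 1 + l 2)⁻¹,
    (l 0 + l 1 + l 2)⁻¹}

end Construction

/-! Write `q = 2 ^ m`. Expanding `(-1) ^ (abc)` in characters turns the Walsh transform of the cubic
into a combination of those of the seven forms `Tr(λ x ^ (q + 1))`, with `λ` a nonzero combination
of the `λ_i`. Each form is bent: completing the square gives Walsh value `-q · (±1)`
(`sum_bitSign_traceNormFun_add`). Hence the weight of a nonzero codeword is `q w / 8`, where `w =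
4q` if `α = 0`, `w = q + 1` if `α = 1, β = 0`, and `|w - 4q| ≤ 7` otherwise
(`hammingNorm_codeStar_cubicFun`).

At least two of the `t_i` equal `1`, so `m ≥ 5` and `32 ∣ q`. This gives weights divisible by `4`,
hence self-orthogonality. A covering would make one value of `w` the sum of two others, which the
list excludes. The values `q + 1` and `4q` break the Ashikhmin–Barg bound. -/

/-! ### Signs and character sums. -/

theorem zmod_two_eq_zero_or_eq_one : ∀ a : ZMod 2, a = 0 ∨ a = 1 := by
  decide

/-- The sign `(-1) ^ a` of a bit. -/
def bitSign (a : ZMod 2) : ℤ := if a = 0 then 1 else -1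

theorem bitSign_zero : bitSign 0 = 1 := rfl

theorem bitSign_add (a b : ZMod 2) : bitSign (a + b) = bitSign a * bitSign b := by
  revert a b; decide

theorem bitSign_eq (a : ZMod 2) : bitSign a = 1 - 2 * (if a ≠ 0 then 1 else 0) := by
  revert a; decide

theorem abs_bitSign (a : ZMod 2) : |bitSign a| ≤ 1 := by
  revert a; decide

/-- The Fourier expansion of the conjunction of three bits; it reduces the cubic to linear
combinations of its factors. -/
theorem four_mul_bitSign_mul_mul (a b c : ZMod 2) :
    4 * bitSign (a * b * c) = 3 + bitSign a + bitSign b + bitSign c - bitSign (a + b)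
      - bitSign (a + c) - bitSign (b + c) + bitSign (a + b + c) := by
  revert a b c; decide

/-- Translation by `v` permutes the terms and flips every sign. -/
theorem sum_bitSign_eq_zero {V : Type*} [AddCommGroup V] [Fintype V] (φ : V →+ ZMod 2)
    {v : V} (hv : φ v ≠ 0) : ∑ x, bitSign (φ x) = 0 := by
  have h : ∑ x, bitSign (φ (x + v)) = ∑ x, bitSign (φ x) :=
    Fintype.sum_equiv (Equiv.addRight v) _ _ fun _ => rfl
  have h' : bitSign (φ v) = -1 := if_neg hv
  simp only [map_add, bitSign_add, h', mul_neg, mul_one, Finset.sum_neg_distrib] at h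
  linarith

theorem sum_bitSign_trace_eq_zero {L : Type*} [Field L] [Fintype L] [Algebra (ZMod 2) L]
    {a : L} (ha : a ≠ 0) : ∑ x : L, bitSign (Algebra.trace (ZMod 2) L (a * x)) = 0 := by
  obtain ⟨y, hy⟩ := Algebra.trace_surjective (ZMod 2) L 1
  refine sum_bitSign_eq_zero
    ((Algebra.trace (ZMod 2) L).toAddMonoidHom.comp (AddMonoidHom.mulLeft a)) (v := a⁻¹ * y) ?_
  have : a * (a⁻¹ * y) = y := mul_inv_cancel_left₀ ha y
  simp [this, hy]

theorem two_mul_hammingNorm_punctured {K : Type*} [Field K] [Fintype K] [DecidableEq K]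
    (g : K → ZMod 2) (hg : g 0 = 0) :
    2 * (hammingNorm (fun x : {x : K // x ≠ 0} => g x.1) : ℤ) =
      Fintype.card K - ∑ x, bitSign (g x) := by
  have h : hammingNorm (fun x : {x : K // x ≠ 0} => g x.1)
      = (Finset.univ.filter fun x : K => g x ≠ 0).card := by
    rw [hammingNorm]
    refine Finset.card_bij (fun x _ => x.1) (by simp) (fun _ _ _ _ h => Subtype.ext h) ?_
    intro b hb
    refine ⟨⟨b, ?_⟩, by simpa using hb, rfl⟩
    rintro rfl
    simp [hg] at hb
  rw [h, Finset.sum_congr rfl fun x _ => bitSign_eq (g x), Finset.sum_sub_distrib,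
    ← Finset.mul_sum, Finset.sum_boole]
  simp

/-! ### The norm map to the subfield and the bent functions built from it. -/

section Norm

variable {K : Type*} [Field K] [Algebra (ZMod 2) K] {m : ℕ}

theorem card_subfieldTwoPow_le [Fintype (subfieldTwoPow K m)] (hm : m ≠ 0) :
    Fintype.card (subfieldTwoPow K m) ≤ 2 ^ m := by
  classical
  have h1 : 1 < 2 ^ m := Nat.one_lt_two_pow hm
  set p : Polynomial K := Polynomial.X ^ 2 ^ m - Polynomial.X
  have hp : p ≠ 0 := FiniteField.X_pow_card_sub_X_ne_zero K h1
  calc Fintype.card (subfieldTwoPow K m) = (Finset.univ.image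
        (fun y : subfieldTwoPow K m => (y : K))).card := by
        rw [Finset.card_image_of_injective _ Subtype.val_injective, Finset.card_univ]
    _ ≤ p.roots.toFinset.card := by
        refine Finset.card_le_card fun y hy => ?_
        obtain ⟨z, -, rfl⟩ := Finset.mem_image.mp hy
        have hz : (z : K) ^ 2 ^ m = z := z.2
        simp [hp, p, hz]
    _ ≤ p.natDegree := (Multiset.toFinset_card_le _).trans p.card_roots'
    _ = 2 ^ m := FiniteField.X_pow_card_sub_X_natDegree_eq K h1

variable [Fintype K]

theorem card_powToSubfield_fiber_le (hK : Fintype.card K = 2 ^ (2 * m))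
    [DecidableEq (subfieldTwoPow K m)] (y : subfieldTwoPow K m) :
    (Finset.univ.filter fun x => powToSubfield hK x = y).card ≤ 2 ^ m + 1 := by
  classical
  calc _ ≤ (Polynomial.nthRoots (2 ^ m + 1) (y : K)).toFinset.card := by
        refine Finset.card_le_card fun x hx => ?_
        have hx : powToSubfield hK x = y := by simpa using hx
        rw [Multiset.mem_toFinset, Polynomial.mem_nthRoots (Nat.succ_pos _), ← hx]
        rfl
    _ ≤ 2 ^ m + 1 := (Multiset.toFinset_card_le _).trans (Polynomial.card_nthRoots _ _)

theorem powToSubfield_eq_zero_iff (hK : Fintype.card K = 2 ^ (2 * m)) (x : K) :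
    powToSubfield hK x = 0 ↔ x = 0 := by
  rw [← Subtype.coe_inj]
  change x ^ (2 ^ m + 1) = 0 ↔ _
  simp

theorem card_powToSubfield_fiber_zero (hK : Fintype.card K = 2 ^ (2 * m))
    [DecidableEq (subfieldTwoPow K m)] :
    (Finset.univ.filter fun x => powToSubfield hK x = 0).card = 1 :=
  Finset.card_eq_one.mpr ⟨0, by ext x; simp [powToSubfield_eq_zero_iff hK]⟩

/-- Root counting gives upper bounds for the subfield and for each fibre. Since `q² = 1 + (q - 1)(q
+ 1)` is the size of `K`, all these bounds are attained. -/
theorem card_subfieldTwoPow_and_fiber (hK : Fintype.card K = 2 ^ (2 * m)) (hm : m ≠ 0)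
    [Fintype (subfieldTwoPow K m)] [DecidableEq (subfieldTwoPow K m)] :
    Fintype.card (subfieldTwoPow K m) = 2 ^ m ∧ ∀ y : subfieldTwoPow K m, y ≠ 0 →
      (Finset.univ.filter fun x => powToSubfield hK x = y).card = 2 ^ m + 1 := by
  set c : subfieldTwoPow K m → ℕ :=
    fun y => (Finset.univ.filter fun x => powToSubfield hK x = y).card
  have h0 : c 0 = 1 := card_powToSubfield_fiber_zero hK
  have hsum : ∑ y, c y = 2 ^ (2 * m) := by
    rw [← hK, ← Finset.card_univ]
    exact (Finset.card_eq_sum_card_fiberwise fun _ _ => Finset.mem_univ _).symm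
  have hle := card_subfieldTwoPow_le (K := K) hm
  have hsum' : c 0 + ∑ y ∈ Finset.univ.erase 0, c y = 2 ^ (2 * m) :=
    (Finset.add_sum_erase _ c (Finset.mem_univ 0)).trans hsum
  have hcard : (Finset.univ.erase (0 : subfieldTwoPow K m)).card + 1
      = Fintype.card (subfieldTwoPow K m) :=
    Finset.card_erase_add_one (Finset.mem_univ 0)
  have hbound : ∑ y ∈ Finset.univ.erase (0 : subfieldTwoPow K m), c y
      ≤ ∑ y ∈ Finset.univ.erase (0 : subfieldTwoPow K m), (2 ^ m + 1) :=
    Finset.sum_le_sum fun y _ => card_powToSubfield_fiber_le hK y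
  have hconst : ∑ y ∈ Finset.univ.erase (0 : subfieldTwoPow K m), (2 ^ m + 1)
      = (Finset.univ.erase (0 : subfieldTwoPow K m)).card * (2 ^ m + 1) := by simp
  have hq : 2 ^ (2 * m) = 2 ^ m * 2 ^ m := by rw [two_mul, pow_add]
  set k := (Finset.univ.erase (0 : subfieldTwoPow K m)).card
  set q := 2 ^ m
  have hk : k + 1 = q := by
    refine le_antisymm (hcard ▸ hle) ?_
    by_contra! hlt
    nlinarith
  refine ⟨hcard ▸ hk, fun y hy => ?_⟩
  have heq := (Finset.sum_eq_sum_iff_of_le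
    (s := Finset.univ.erase (0 : subfieldTwoPow K m)) (f := c) (g := fun _ => q + 1)
    fun y _ => card_powToSubfield_fiber_le hK y).mp (by
      rw [hconst]; nlinarith)
  exact heq y (Finset.mem_erase.mpr ⟨hy, Finset.mem_univ y⟩)

/-- Summing over norm fibres, zero contributes `1` and the nonzero `y`, whose signs sum to `-1`,
contribute `-(q + 1)`. -/
theorem sum_bitSign_traceNormFun (hK : Fintype.card K = 2 ^ (2 * m)) (hm : m ≠ 0)
    {l : subfieldTwoPow K m} (hl : l ≠ 0) :
    ∑ x, bitSign (traceNormFun hK l x) = -2 ^ m := by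
  classical
  have : Fintype (subfieldTwoPow K m) := Fintype.ofFinite _
  obtain ⟨-, hfib⟩ := card_subfieldTwoPow_and_fiber hK hm
  let F := subfieldTwoPow K m
  have key : ∑ x, bitSign (traceNormFun hK l x) = ∑ y : F,
      ((Finset.univ.filter fun x => powToSubfield hK x = y).card : ℤ)
        * bitSign (Algebra.trace (ZMod 2) F (l * y)) := by
    rw [← Finset.sum_fiberwise Finset.univ (powToSubfield hK)]
    refine Finset.sum_congr rfl fun y _ => ?_
    rw [Finset.sum_congr rfl (g := fun _ => bitSign (Algebra.trace (ZMod 2) F (l * y))),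
      Finset.sum_const, nsmul_eq_mul]
    intro x hx
    rw [traceNormFun, (Finset.mem_filter.mp hx).2]
  have htot := sum_bitSign_trace_eq_zero hl
  rw [← Finset.add_sum_erase _ _ (Finset.mem_univ (0 : F))] at htot key
  rw [key, card_powToSubfield_fiber_zero hK, Finset.sum_congr rfl (g := fun y =>
    (2 ^ m + 1 : ℤ) * bitSign (Algebra.trace (ZMod 2) F (l * y))), ← Finset.mul_sum]
  · simp only [mul_zero, map_zero, bitSign_zero] at htot ⊢
    rw [eq_neg_of_add_eq_zero_right htot]
    push_cast
    ring
  · intro y hy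
    rw [hfib y (Finset.ne_of_mem_erase hy)]
    push_cast
    rfl

theorem trace_eq_trace_subfieldTwoPow (hK : Fintype.card K = 2 ^ (2 * m)) (hm : m ≠ 0)
    (z : K) (t : subfieldTwoPow K m) (ht : (t : K) = z + z ^ 2 ^ m) :
    Algebra.trace (ZMod 2) K z = Algebra.trace (ZMod 2) (subfieldTwoPow K m) t := by
  classical
  have : Fintype (subfieldTwoPow K m) := Fintype.ofFinite _
  have hcard := (card_subfieldTwoPow_and_fiber hK hm).1
  rw [← Algebra.trace_trace (S := subfieldTwoPow K m)]
  congr 1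
  have hfin : Module.finrank (subfieldTwoPow K m) K = 2 := by
    have := Module.card_eq_pow_finrank (K := subfieldTwoPow K m) (V := K)
    rw [hcard, hK, ← pow_mul] at this
    have := Nat.pow_right_injective le_rfl this
    rw [mul_comm] at this
    exact (Nat.eq_of_mul_eq_mul_left (Nat.pos_of_ne_zero hm) this).symm
  apply (algebraMap (subfieldTwoPow K m) K).injective
  rw [FiniteField.algebraMap_trace_eq_sum_pow, hfin]
  simp [Finset.sum_range_succ, hcard, ht]

theorem sum_bitSign_traceNormFun_add (hK : Fintype.card K = 2 ^ (2 * m)) (hm : m ≠ 0)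
    {l : subfieldTwoPow K m} (hl : l ≠ 0) (β : K) :
    ∑ x, bitSign (traceNormFun hK l x + Algebra.trace (ZMod 2) K (β * x)) =
      -2 ^ m * bitSign (traceNormFun hK l⁻¹ β) := by
  have : CharP K 2 := charP_of_injective_algebraMap (algebraMap (ZMod 2) K).injective 2
  have hlK : (l : K) ≠ 0 := by simpa using hl
  have hlq : (l : K) ^ 2 ^ m = l := l.2
  have hβq : (β ^ 2 ^ m) ^ 2 ^ m = β := by
    rw [← pow_mul, ← pow_add, ← two_mul, ← hK, FiniteField.pow_card]
  -- Completing the square: the cross terms of the shifted norm are `βx + (βx) ^ q`, whose subfield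
  -- trace is the trace of `βx` from `K`. The constant term `β ^ (q + 1) / l` occurs twice and
  -- cancels.
  have key : ∀ x, traceNormFun hK l (x + β ^ 2 ^ m / l) + traceNormFun hK l⁻¹ β
      = traceNormFun hK l x + Algebra.trace (ZMod 2) K (β * x) := by
    intro x
    have hmem : β * x + (β * x) ^ 2 ^ m ∈ subfieldTwoPow K m := by
      change (β * x + (β * x) ^ 2 ^ m) ^ 2 ^ m = _
      have : ((β * x) ^ 2 ^ m) ^ 2 ^ m = β * x := by
        rw [← pow_mul, ← pow_add, ← two_mul, ← hK, FiniteField.pow_card]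
      rw [add_pow_char_pow, this, add_comm]
    rw [trace_eq_trace_subfieldTwoPow hK hm _ ⟨_, hmem⟩ rfl]
    simp only [traceNormFun]
    rw [← map_add, ← map_add]
    congr 1
    apply Subtype.ext
    change (l : K) * (x + β ^ 2 ^ m / l) ^ (2 ^ m + 1) + (l : K)⁻¹ * β ^ (2 ^ m + 1)
      = l * x ^ (2 ^ m + 1) + (β * x + (β * x) ^ 2 ^ m)
    rw [pow_succ, add_pow_char_pow, div_pow, hβq, hlq, pow_succ, pow_succ, mul_pow]
    field_simp
    have h2 : (2 : K) = 0 := CharTwo.two_eq_zero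
    linear_combination (β ^ 2 ^ m * β) * h2
  simp only [← key, bitSign_add]
  rw [← Finset.sum_mul, ← sum_bitSign_traceNormFun hK hm hl]
  congr 1
  exact Fintype.sum_equiv (Equiv.addRight (β ^ 2 ^ m / (l : K))) _ _ fun _ => rfl

end Norm

/-! ### Weights in binary codes. -/

section BinaryCodes

variable {ι : Type*} [Fintype ι]

theorem hammingNorm_add_two_mul_card (a b : ι → ZMod 2) :
    hammingNorm (a + b) + 2 * (Finset.univ.filter fun i => a i ≠ 0 ∧ b i ≠ 0).card =
      hammingNorm a + hammingNorm b := by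
  simp only [hammingNorm, Finset.card_filter, Finset.mul_sum, ← Finset.sum_add_distrib]
  refine Finset.sum_congr rfl fun i _ => ?_
  rw [Pi.add_apply]
  rcases zmod_two_eq_zero_or_eq_one (a i) with h | h <;>
    rcases zmod_two_eq_zero_or_eq_one (b i) with h' | h' <;> simp [h, h', CharTwo.add_self_eq_zero]

theorem dotProduct_eq_card (a b : ι → ZMod 2) :
    a ⬝ᵥ b = ((Finset.univ.filter fun i => a i ≠ 0 ∧ b i ≠ 0).card : ZMod 2) := by
  rw [Finset.card_filter, Nat.cast_sum]
  refine Finset.sum_congr rfl fun i _ => ?_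
  generalize a i = x
  generalize b i = y
  revert x y
  decide

/-- Twice the size of the common support is a combination of three weights divisible by `4`, so that
size is even. -/
theorem IsDoublyEven.isSelfOrthogonal {C : Submodule (ZMod 2) (ι → ZMod 2)}
    (hC : IsDoublyEven C) : IsSelfOrthogonal C := by
  intro a ha b hb
  have h := hammingNorm_add_two_mul_card a b
  have h1 := hC a ha
  have h2 := hC b hb
  have h3 := hC _ (C.add_mem ha hb)
  rw [dotProduct_eq_card, ZMod.natCast_eq_zero_iff]
  omega

/-- Turns a covering into an additive relation between weights of codewords. -/
theorem Covers.hammingNorm_eq_add {a b : ι → ZMod 2} (h : Covers a b) :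
    hammingNorm a = hammingNorm b + hammingNorm (a + b) := by
  simp only [hammingNorm, Finset.card_filter, ← Finset.sum_add_distrib]
  refine Finset.sum_congr rfl fun i _ => ?_
  have hi : b i ≠ 0 → a i ≠ 0 := fun hb => h hb
  rw [Pi.add_apply]
  rcases zmod_two_eq_zero_or_eq_one (a i) with h | h <;>
    rcases zmod_two_eq_zero_or_eq_one (b i) with h' | h' <;>
    simp_all [CharTwo.add_self_eq_zero]

/-- A nonzero weight which is at least twice another one rules out the Ashikhmin–Barg
condition. -/
theorem violatesAshikhminBarg_of_two_mul_le {C : Submodule (ZMod 2) (ι → ZMod 2)}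
    {v w : ℕ} (hv : v ∈ nonzeroWeights C) (hw : w ∈ nonzeroWeights C) (hvw : 2 * v ≤ w) :
    ViolatesAshikhminBarg C := by
  have hfin : (nonzeroWeights C).Finite := by
    refine (Set.finite_Iic (Fintype.card ι)).subset ?_
    rintro _ ⟨c, -, -, rfl⟩
    exact hammingNorm_le_card_fintype
  obtain ⟨a, ha, ha'⟩ := Set.exists_min_image _ id hfin ⟨v, hv⟩
  obtain ⟨b, hb, hb'⟩ := Set.exists_max_image _ id hfin ⟨v, hv⟩
  refine ⟨a, b, ⟨ha, ha'⟩, ⟨hb, hb'⟩, ?_⟩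
  have h1 : a ≤ v := ha' v hv
  have h2 : w ≤ b := hb' w hw
  have hb0 : 0 < b := by
    obtain ⟨c, -, hc, rfl⟩ := hb
    exact hammingNorm_pos_iff.mpr hc
  have hab : (2 * a : ℚ) ≤ b := by exact_mod_cast (by omega : 2 * a ≤ b)
  rw [not_lt, Nat.card_zmod, div_le_iff₀ (by exact_mod_cast hb0)]
  norm_num
  linarith

end BinaryCodes

/-! ### Which of the inverse relations can hold. -/

section Relations

theorem linearIndependent_fin_three_ne {R M : Type*} [Ring R] [AddCommGroup M] [Module R M]
    {l : Fin 3 → M} (hl : LinearIndependent R l) (x y z : R) (hxyz : x ≠ 0 ∨ y ≠ 0 ∨ z ≠ 0) :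
    x • l 0 + y • l 1 + z • l 2 ≠ 0 := by
  intro h
  have := Fintype.linearIndependent_iff.mp hl ![x, y, z] (by simpa [Fin.sum_univ_three] using h)
  rcases hxyz with h | h | h
  exacts [h (this 0), h (this 1), h (this 2)]

variable {F : Type*} [Field F]

theorem inv_add_add_ne {a b c : F} (ha : a ≠ 0) (hb : b ≠ 0) (hc : c ≠ 0) (hab : a + b ≠ 0)
    (hac : a + c ≠ 0) (hbc : b + c ≠ 0) (habc : a + b + c ≠ 0) :
    (a + b + c)⁻¹ ≠ a⁻¹ + b⁻¹ + c⁻¹ := by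
  intro h
  field_simp at h
  -- `(a + b + c)(ab + bc + ca) - abc = (a + b)(a + c)(b + c)`.
  refine mul_ne_zero (mul_ne_zero hab hac) hbc ?_
  linear_combination (-1 : F) * h

variable [CharP F 2]

theorem not_inv_add_eq_and_inv_add_eq {a b c : F} (ha : a ≠ 0) (hb : b ≠ 0) (hc : c ≠ 0)
    (hab : a + b ≠ 0) (hac : a + c ≠ 0) (hbc : b + c ≠ 0) (habc : a + b + c ≠ 0)
    (h1 : (a + b)⁻¹ = a⁻¹ + b⁻¹) : (a + c)⁻¹ ≠ a⁻¹ + c⁻¹ := by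
  intro h
  field_simp at h h1
  have h2 : (2 : F) = 0 := CharTwo.two_eq_zero
  -- The relations read `a² + ab + b² = 0` and `a² + ac + c² = 0`; their sum factors as `(b + c)(a +
  -- b + c)`.
  refine mul_ne_zero hbc habc ?_
  linear_combination h - h1 + (c ^ 2 + b * c + a * c) * h2

theorem two_le_hammingNorm_relationVec [Algebra (ZMod 2) F] {l : Fin 3 → F}
    (hl : LinearIndependent (ZMod 2) l) : 2 ≤ hammingNorm (relationVec l) := by
  have hne := linearIndependent_fin_three_ne hl
  have ha : l 0 ≠ 0 := by simpa using hne 1 0 0 (by simp)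
  have hb : l 1 ≠ 0 := by simpa using hne 0 1 0 (by simp)
  have hc : l 2 ≠ 0 := by simpa using hne 0 0 1 (by simp)
  have hab : l 0 + l 1 ≠ 0 := by simpa using hne 1 1 0 (by simp)
  have hac : l 0 + l 2 ≠ 0 := by simpa using hne 1 0 1 (by simp)
  have hbc : l 1 + l 2 ≠ 0 := by simpa using hne 0 1 1 (by simp)
  have habc : l 0 + l 1 + l 2 ≠ 0 := by simpa using hne 1 1 1 (by simp)
  have h0 : relationVec l 0 ≠ 0 := by
    simp [relationVec, inv_add_add_ne ha hb hc hab hac hbc habc]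
  have h12 : relationVec l 1 ≠ 0 ∨ relationVec l 2 ≠ 0 := by
    by_cases h : (l 0 + l 1)⁻¹ = (l 0)⁻¹ + (l 1)⁻¹
    · right
      simp [relationVec, not_inv_add_eq_and_inv_add_eq ha hb hc hab hac hbc habc h]
    · left
      simp [relationVec, h]
  obtain ⟨i, hi0, hi⟩ : ∃ i : Fin 4, i ≠ 0 ∧ relationVec l i ≠ 0 := by
    rcases h12 with h | h
    exacts [⟨1, by decide, h⟩, ⟨2, by decide, h⟩]
  refine (Finset.card_pair hi0).ge.trans (Finset.card_le_card fun j hj => ?_)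
  rcases Finset.mem_insert.mp hj with rfl | hj
  · simpa using hi
  · rw [Finset.mem_singleton.mp hj]
    simpa using h0

end Relations

/-! ### Walsh transform of the cubic and weights of the code. -/

section Weights

variable {K : Type*} [Field K] [Fintype K] [Algebra (ZMod 2) K] {m : ℕ}

theorem traceNormFun_add (hK : Fintype.card K = 2 ^ (2 * m)) (l l' : subfieldTwoPow K m) (x : K) :
    traceNormFun hK (l + l') x = traceNormFun hK l x + traceNormFun hK l' x := by
  simp only [traceNormFun, add_mul, map_add]

theorem traceNormFun_zero (hK : Fintype.card K = 2 ^ (2 * m)) (l : subfieldTwoPow K m) :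
    traceNormFun hK l 0 = 0 := by
  simp only [traceNormFun, (powToSubfield_eq_zero_iff hK 0).mpr rfl, mul_zero, map_zero]

/-- The Walsh transform of the cubic function, up to the factor four. -/
theorem four_mul_sum_bitSign_cubicFun_add (hK : Fintype.card K = 2 ^ (2 * m)) (hm : m ≠ 0)
    {l : Fin 3 → subfieldTwoPow K m} (hl : LinearIndependent (ZMod 2) l) (β : K) :
    ∃ D : ℤ, |D| ≤ 7 ∧ (β = 0 → D = 1) ∧
      4 * ∑ x, bitSign (cubicFun hK l x + Algebra.trace (ZMod 2) K (β * x)) =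
        3 * ∑ x, bitSign (Algebra.trace (ZMod 2) K (β * x)) - 2 ^ m * D := by
  have hne := linearIndependent_fin_three_ne hl
  have ha : l 0 ≠ 0 := by simpa using hne 1 0 0 (by simp)
  have hb : l 1 ≠ 0 := by simpa using hne 0 1 0 (by simp)
  have hc : l 2 ≠ 0 := by simpa using hne 0 0 1 (by simp)
  have hab : l 0 + l 1 ≠ 0 := by simpa using hne 1 1 0 (by simp)
  have hac : l 0 + l 2 ≠ 0 := by simpa using hne 1 0 1 (by simp)
  have hbc : l 1 + l 2 ≠ 0 := by simpa using hne 0 1 1 (by simp)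
  have habc : l 0 + l 1 + l 2 ≠ 0 := by simpa using hne 1 1 1 (by simp)
  have hA := sum_bitSign_traceNormFun_add hK hm ha β
  have hB := sum_bitSign_traceNormFun_add hK hm hb β
  have hC := sum_bitSign_traceNormFun_add hK hm hc β
  have hAB := sum_bitSign_traceNormFun_add hK hm hab β
  have hAC := sum_bitSign_traceNormFun_add hK hm hac β
  have hBC := sum_bitSign_traceNormFun_add hK hm hbc β
  have hABC := sum_bitSign_traceNormFun_add hK hm habc β
  refine ⟨bitSign (traceNormFun hK (l 0)⁻¹ β) + bitSign (traceNormFun hK (l 1)⁻¹ β)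
    + bitSign (traceNormFun hK (l 2)⁻¹ β) - bitSign (traceNormFun hK (l 0 + l 1)⁻¹ β)
    - bitSign (traceNormFun hK (l 0 + l 2)⁻¹ β) - bitSign (traceNormFun hK (l 1 + l 2)⁻¹ β)
    + bitSign (traceNormFun hK (l 0 + l 1 + l 2)⁻¹ β), ?_, ?_, ?_⟩
  · have h := fun a : subfieldTwoPow K m => abs_le.mp (abs_bitSign (traceNormFun hK a β))
    have := h (l 0)⁻¹
    have := h (l 1)⁻¹
    have := h (l 2)⁻¹
    have := h (l 0 + l 1)⁻¹
    have := h (l 0 + l 2)⁻¹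
    have := h (l 1 + l 2)⁻¹
    have := h (l 0 + l 1 + l 2)⁻¹
    rw [abs_le]
    omega
  · rintro rfl
    simp only [traceNormFun_zero, bitSign_zero]
    norm_num
  · have key : 4 * ∑ x, bitSign (cubicFun hK l x + Algebra.trace (ZMod 2) K (β * x)) =
        ∑ x, (3 * bitSign (Algebra.trace (ZMod 2) K (β * x))
          + bitSign (traceNormFun hK (l 0) x + Algebra.trace (ZMod 2) K (β * x))
          + bitSign (traceNormFun hK (l 1) x + Algebra.trace (ZMod 2) K (β * x))
          + bitSign (traceNormFun hK (l 2) x + Algebra.trace (ZMod 2) K (β * x))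
          - bitSign (traceNormFun hK (l 0 + l 1) x + Algebra.trace (ZMod 2) K (β * x))
          - bitSign (traceNormFun hK (l 0 + l 2) x + Algebra.trace (ZMod 2) K (β * x))
          - bitSign (traceNormFun hK (l 1 + l 2) x + Algebra.trace (ZMod 2) K (β * x))
          + bitSign (traceNormFun hK (l 0 + l 1 + l 2) x
            + Algebra.trace (ZMod 2) K (β * x))) := by
      rw [Finset.mul_sum]
      refine Finset.sum_congr rfl fun x _ => ?_
      rw [bitSign_add, ← mul_assoc, cubicFun, four_mul_bitSign_mul_mul]
      simp only [traceNormFun_add, bitSign_add]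
      ring
    rw [key]
    simp only [Finset.sum_add_distrib, Finset.sum_sub_distrib, ← Finset.mul_sum]
    rw [hA, hB, hC, hAB, hAC, hBC, hABC]
    ring

theorem hammingNorm_codeStar_cubicFun [DecidableEq K]
    (hK : Fintype.card K = 2 ^ (2 * m)) (hm : m ≠ 0)
    {l : Fin 3 → subfieldTwoPow K m} (hl : LinearIndependent (ZMod 2) l) (α : ZMod 2) (β : K)
    (hαβ : α ≠ 0 ∨ β ≠ 0) :
    ∃ w : ℤ, 8 * (hammingNorm (fun x : {x : K // x ≠ 0} =>
          α * cubicFun hK l x.1 - Algebra.trace (ZMod 2) K (β * x.1)) : ℤ) = 2 ^ m * w ∧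
      (α = 0 → w = 4 * 2 ^ m) ∧ (α ≠ 0 → β = 0 → w = 2 ^ m + 1) ∧
      (α ≠ 0 → w = 2 ^ m + 1 ∨ |w - 4 * 2 ^ m| ≤ 7) := by
  have hnorm := two_mul_hammingNorm_punctured
    (fun x => α * cubicFun hK l x - Algebra.trace (ZMod 2) K (β * x))
    (by simp [cubicFun, traceNormFun_zero])
  have hcard : (Fintype.card K : ℤ) = 2 ^ m * 2 ^ m := by
    rw [hK, two_mul, pow_add]
    push_cast
    rfl
  rw [hcard] at hnorm
  simp only [CharTwo.sub_eq_add] at hnorm ⊢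
  rcases zmod_two_eq_zero_or_eq_one α with rfl | rfl
  · have hβ : β ≠ 0 := by simpa using hαβ
    simp only [zero_mul, zero_add, sum_bitSign_trace_eq_zero hβ] at hnorm ⊢
    exact ⟨4 * 2 ^ m, by linarith, by simp⟩
  · obtain ⟨D, hD, hD0, h⟩ := four_mul_sum_bitSign_cubicFun_add hK hm hl β
    simp only [one_mul] at hnorm ⊢
    by_cases hβ : β = 0
    · refine ⟨2 ^ m + 1, ?_, by simp, by simp, fun _ => Or.inl rfl⟩
      rw [hD0 hβ] at h
      have h1 : ∑ x, bitSign (Algebra.trace (ZMod 2) K (β * x)) = (2 ^ m * 2 ^ m : ℤ) := by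
        simp [hβ, bitSign_zero, hcard]
      rw [h1] at h
      linarith
    · refine ⟨4 * 2 ^ m + D, ?_, by simp, fun _ h => absurd h hβ, fun _ =>
        Or.inr (by simpa using hD)⟩
      rw [sum_bitSign_trace_eq_zero hβ] at h
      linarith

end Weights

/-! ### The four properties of the code. -/

theorem corollary1 {K : Type*} [Field K] [Fintype K] [DecidableEq K] [Algebra (ZMod 2) K]
    (m : ℕ) (hK : Fintype.card K = 2 ^ (2 * m))
    (l : Fin 3 → subfieldTwoPow K m)
    (hl : LinearIndependent (ZMod 2) l)
    (hm : hammingNorm (relationVec l) + 3 ≤ m)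
    (hrank : Module.finrank (ZMod 2) (Submodule.span (ZMod 2) (inverseSet l)) =
      hammingNorm (relationVec l) + 3) :
    IsSelfOrthogonal (codeStar (cubicFun hK l)) ∧
      IsDoublyEven (codeStar (cubicFun hK l)) ∧
      IsMinimalCode (codeStar (cubicFun hK l)) ∧
      ViolatesAshikhminBarg (codeStar (cubicFun hK l)) := by
  have : CharP (subfieldTwoPow K m) 2 :=
    charP_of_injective_algebraMap (algebraMap (ZMod 2) (subfieldTwoPow K m)).injective 2
  have hm5 : 5 ≤ m := by
    have := two_le_hammingNorm_relationVec hl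
    omega
  have hm0 : m ≠ 0 := by omega
  -- The factor `32` yields `4 ∣` weight from `8 · weight = q w`; `q ≥ 32` also separates the
  -- possible values of `w`.
  obtain ⟨k, hk, hq⟩ : ∃ k : ℤ, 0 < k ∧ (2 : ℤ) ^ m = 32 * k :=
    ⟨2 ^ (m - 5), by positivity, by
      rw [show (32 : ℤ) = 2 ^ 5 by norm_num, ← pow_add, Nat.add_sub_cancel' hm5]⟩
  have hwt := hammingNorm_codeStar_cubicFun hK hm0 hl
  have hzero : ∀ α β, (fun x : {x : K // x ≠ 0} =>
      α * cubicFun hK l x.1 - Algebra.trace (ZMod 2) K (β * x.1)) ≠ 0 → α ≠ 0 ∨ β ≠ 0 := by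
    intro α β h
    contrapose! h
    funext x
    simp [h.1, h.2]
  have heven : IsDoublyEven (codeStar (cubicFun hK l)) := by
    rintro c ⟨α, β, rfl⟩
    by_cases hαβ : α ≠ 0 ∨ β ≠ 0
    · obtain ⟨w, hw, -⟩ := hwt α β hαβ
      rw [hq] at hw
      rw [← Int.natCast_dvd_natCast]
      exact ⟨k * w, by push_cast; linarith⟩
    · rw [hammingNorm_eq_zero.mpr (not_not.mp (mt (hzero α β) hαβ))]
      exact dvd_zero 4
  refine ⟨heven.isSelfOrthogonal, heven, ?_, ?_⟩
  · rintro a ha ha0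
    refine ⟨ha, ha0, fun b hb hab => ?_⟩
    by_cases hb0 : b = 0
    · exact ⟨0, by simp [hb0]⟩
    refine ⟨1, ?_⟩
    rw [one_smul]
    by_contra hne
    have hc0 : a + b ≠ 0 := fun h => hne (funext fun i =>
      (CharTwo.add_eq_zero.mp (congrFun h i)).symm)
    have hsum := hab.hammingNorm_eq_add
    obtain ⟨α, β, rfl⟩ := ha
    obtain ⟨α', β', rfl⟩ := hb
    have hadd : (fun x : {x : K // x ≠ 0} =>
          α * cubicFun hK l x.1 - Algebra.trace (ZMod 2) K (β * x.1)) + (fun x =>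
          α' * cubicFun hK l x.1 - Algebra.trace (ZMod 2) K (β' * x.1)) = fun x =>
          (α + α') * cubicFun hK l x.1 - Algebra.trace (ZMod 2) K ((β + β') * x.1) := by
      funext x
      simp only [Pi.add_apply, add_mul, map_add]
      ring
    rw [hadd] at hsum hc0
    obtain ⟨u, hu, hu0, -, hu2⟩ := hwt α β (hzero _ _ ha0)
    obtain ⟨v, hv, hv0, -, hv2⟩ := hwt α' β' (hzero _ _ hb0)
    obtain ⟨w, hw, hw0, -, hw2⟩ := hwt (α + α') (β + β') (hzero _ _ hc0)
    have huvw : u = v + w := by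
      have hq0 : (2 : ℤ) ^ m ≠ 0 := by positivity
      refine mul_left_cancel₀ hq0 ?_
      rw [mul_add, ← hu, ← hv, ← hw, hsum]
      push_cast
      ring
    rw [hq] at hu0 hu2 hv0 hv2 hw0 hw2
    simp only [abs_le] at hu2 hv2 hw2
    -- `u = v + w` fails by size. With exactly one of the three words linear, it reads `4q = v + w`
    -- or makes `u` exceed `4q + 7`; sums of two nonlinear values are `2q + 2` or at least `5q - 6`.
    rcases zmod_two_eq_zero_or_eq_one α with rfl | rfl <;>
      rcases zmod_two_eq_zero_or_eq_one α' with rfl | rfl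
    · have := hu0 rfl
      have := hv0 rfl
      have := hw0 (add_zero 0)
      omega
    · have := hu0 rfl
      have := hv2 one_ne_zero
      have := hw2 (by decide)
      omega
    · have := hu2 one_ne_zero
      have := hv0 rfl
      have := hw2 (by decide)
      omega
    · have := hu2 one_ne_zero
      have := hv2 one_ne_zero
      have := hw0 (by decide)
      omega
  -- The cubic itself has weight `q(q + 1)/8`, at most half the weight `q²/2` of a linear word.
  · obtain ⟨w, hw, -, hw1, -⟩ := hwt 1 0 (by simp)
    obtain ⟨u, hu, hu1, -⟩ := hwt 0 1 (by simp)
    have hw1 := hw1 one_ne_zero rfl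
    have hu1 := hu1 rfl
    rw [hw1, hq] at hw
    rw [hu1, hq] at hu
    refine violatesAshikhminBarg_of_two_mul_le ⟨_, ⟨1, 0, rfl⟩, ?_, rfl⟩
      ⟨_, ⟨0, 1, rfl⟩, ?_, rfl⟩ ?_
    · intro h
      rw [hammingNorm_eq_zero.mpr h] at hw
      push_cast at hw
      nlinarith
    · intro h
      rw [hammingNorm_eq_zero.mpr h] at hu
      push_cast at hu
      nlinarith
    · zify
      nlinarith
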